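/- A trigonometric polynomial is a function $\mu(\mathbf r)=\sum_{\mathbf k\in\Lambda}c[\mathbf k]\,e^{2\pi i\langle \mathbf k,\mathbf r\rangle}$ with $\Lambda\subset\mathbb Z^2$ finite and $c[\mathbf k]\in\mathbb C$; it is regarded as a $\mathbb Z^2$-periodic function on $\mathbb R^2$, and its zero set is $\{\mu=0\}=\{\mathbf r\in[0,1]^2:\mu(\mathbf r)=0\}$. Its degree $\deg(\mu)=(K,L)$ consists of the dimensions (numbers of lattice points along each side) of the smallest rectangle in $\mathbb Z^2$ containing the frequency support $\{\mathbf k: c[\mathbf k]\neq0\}$ (with $\deg(0)=(0,0)$); degrees are compared componentwise. We say that $\nu$ divides $\mu$, written $\nu\mid\mu$, if $\mu=\nu\gamma$ for some trigonometric polynomial $\gamma$. A trigonometric curve is a set $C\subset[0,1]^2$ that is the zero set of a trigonometric polynomial $\mu$ whose periodic zero set $\{\mathbf r\in\mathbb R^2:\mu(\mathbf r)=0\}$ has no isolated points. **Proposition.** For every trigonometric curve $C$ there is a trigonometric polynomial $\mu_0$ with zero set exactly $C$ such that every trigonometric polynomial $\mu$ with zero set exactly $C$ satisfies $\deg(\mu_0)\le\deg(\mu)$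 and $\mu_0\mid\mu$. It is unique up to scaling and frequency shift: a trigonometric polynomial $\mu_1$ has the same property if and only if $\mu_1(\mathbf r)=a\,e^{2\pi i\langle\mathbf k,\mathbf r\rangle}\mu_0(\mathbf r)$ for some $a\in\mathbb C\setminus\{0\}$ and $\mathbf k\in\mathbb Z^2$. In particular, if such a $\mu_1$ has the same smallest frequency rectangle as $\mu_0$, then $\mu_1=a\mu_0$ for some $a\in\mathbb C\setminus\{0\}$. -/

import Mathlib

/-- A trigonometric polynomial on the plane, given by its finitely supported family of complex
Fourier coefficients `c[k]`, `k ∈ ℤ²`.  Its support is the frequency support set. -/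
abbrev TrigPoly : Type := (ℤ × ℤ) →₀ ℂ

namespace TrigPoly

/-- The exponential `e_k (r) = exp (2 π i ⟨k, r⟩)`. -/
noncomputable def expo (k : ℤ × ℤ) (r : ℝ × ℝ) : ℂ :=
  Complex.exp (2 * (Real.pi : ℂ) * Complex.I * ((k.1 : ℂ) * (r.1 : ℂ) + (k.2 : ℂ) * (r.2 : ℂ)))

/-- The function `μ (r) = ∑ c[k] exp (2 π i ⟨k, r⟩)`, as a `ℤ²`-periodic function on `ℝ²`. -/
noncomputable def eval (c : TrigPoly) (r : ℝ × ℝ) : ℂ :=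
  ∑ k ∈ c.support, c k * expo k r

/-- The zero set of `μ` in the unit square `[0,1]²`. -/
def zeroSet (c : TrigPoly) : Set (ℝ × ℝ) :=
  {r | r ∈ Set.Icc (0 : ℝ) 1 ×ˢ Set.Icc (0 : ℝ) 1 ∧ c.eval r = 0}

/-- The smallest integer interval containing a finite set of integers
(empty if the set is empty). -/
noncomputable def intHull (S : Finset ℤ) : Finset ℤ :=
  S.biUnion fun a => S.biUnion fun b => Finset.Icc a b

theorem subset_intHull (S : Finset ℤ) : S ⊆ intHull S := by
  intro a ha
  simp only [intHull, Finset.mem_biUnion, Finset.mem_Icc]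
  exact ⟨a, ha, a, ha, le_refl a, le_refl a⟩

theorem intHull_subset_Icc {S : Finset ℤ} {a b : ℤ} (h : S ⊆ Finset.Icc a b) :
    intHull S ⊆ Finset.Icc a b := by
  intro n hn
  simp only [intHull, Finset.mem_biUnion, Finset.mem_Icc] at hn
  obtain ⟨x, hx, y, hy, h1, h2⟩ := hn
  have hx' := Finset.mem_Icc.1 (h hx)
  have hy' := Finset.mem_Icc.1 (h hy)
  exact Finset.mem_Icc.2 ⟨hx'.1.trans h1, h2.trans hy'.2⟩

theorem intHull_eq_Icc {S : Finset ℤ} (h : S.Nonempty) :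
    intHull S = Finset.Icc (S.min' h) (S.max' h) := by
  apply Finset.Subset.antisymm
  · apply intHull_subset_Icc
    intro n hn
    exact Finset.mem_Icc.2 ⟨S.min'_le n hn, S.le_max' n hn⟩
  · intro n hn
    simp only [intHull, Finset.mem_biUnion]
    exact ⟨_, S.min'_mem h, _, S.max'_mem h, hn⟩

/-- The smallest rectangle `{k₁, …, k₁'} × {k₂, …, k₂'}` in `ℤ²` containing the frequency
support. -/
noncomputable def freqRect (c : TrigPoly) : Finset (ℤ × ℤ) :=
  intHull (c.support.image Prod.fst) ×ˢ intHull (c.support.image Prod.snd)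

/-- The degree `(K, L)`: the dimensions, counted in lattice points, of the smallest rectangle
containing the frequency support.  Degrees are compared componentwise, by the product order
on `ℕ × ℕ`. -/
noncomputable def degree (c : TrigPoly) : ℕ × ℕ :=
  ((intHull (c.support.image Prod.fst)).card, (intHull (c.support.image Prod.snd)).card)

/-- `ν` divides `μ`: there is a trigonometric polynomial `γ` with `μ = ν · γ` as functions. -/
def Divides (ν μ : TrigPoly) : Prop :=
  ∃ γ : TrigPoly, ∀ r : ℝ × ℝ, μ.eval r = ν.eval r * γ.eval r

end TrigPoly

/-- A trigonometric curve: the zero set in `[0,1]²` of a trigonometric polynomial, which, viewed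
periodically, has no isolated points. -/
def IsTrigCurve (C : Set (ℝ × ℝ)) : Prop :=
  ∃ μ : TrigPoly, μ.zeroSet = C ∧ Preperfect {r : ℝ × ℝ | μ.eval r = 0}

/-- `μ₀` has zero set `C`, and every trigonometric polynomial with zero set `C` has degree at
least that of `μ₀` and is divisible by `μ₀`. -/
def IsMinimalTrigPoly (C : Set (ℝ × ℝ)) (μ₀ : TrigPoly) : Prop :=
  μ₀.zeroSet = C ∧
    ∀ μ : TrigPoly, μ.zeroSet = C → μ₀.degree ≤ μ.degree ∧ μ₀.Divides μ

/-! After multiplication by an exponential, a trigonometric polynomial is an ordinary polynomial `p`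
in two variables restricted to the torus. Factor a nonzero `p` into primes and keep one copy of each
prime with infinitely many zeros on the torus. The product `q` of these divides every polynomial `f`
vanishing on its torus zeros, because an irreducible polynomial has only finitely many common zeros
with one it does not divide (`finite_common_zeros`, `exists_dvd_of_vanishing`). The discarded primes
account for at most finitely many torus points, and a zero set without isolated points cannot
contain just these in addition (`eval_eq_zero_of_finite_diff`), so `q` has zero set exactly `C`. The
degree bound follows from divisibility, since extreme exponents add under multiplication. Uniqueness
holds because mutual divisors differ by a unit, and the units of the Laurent ring are monomials. -/

/-! ### Common zeros of bivariate polynomials -/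

open Polynomial in
theorem Polynomial.Bivariate.evalEval_swap (x y : ℂ) (p : ℂ[X][X]) :
    (Bivariate.swap p).evalEval x y = p.evalEval y x := by
  rw [← coe_aevalAeval_eq_evalEval, ← coe_aevalAeval_eq_evalEval, Bivariate.aevalAeval_swap]

open Polynomial in
/-- An irreducible bivariate polynomial and a polynomial it does not divide
have common zeros over finitely many abscissae only. -/
theorem Polynomial.exists_ne_zero_eval_eq_zero_of_not_dvd {p q : ℂ[X][X]} (hp : Irreducible p)
    (hpq : ¬ p ∣ q) :
    ∃ d : ℂ[X], d ≠ 0 ∧ ∀ x y, p.evalEval x y = 0 → q.evalEval x y = 0 → d.eval x = 0 := by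
  by_cases hdeg : p.natDegree = 0
  · obtain ⟨c, rfl⟩ := natDegree_eq_zero.1 hdeg
    refine ⟨c, fun h => hp.ne_zero (by rw [h, C_0]), fun x y h _ => ?_⟩
    rwa [evalEval_C] at h
  · have hprim := hp.isPrimitive hdeg
    have hirr : Irreducible (p.map (algebraMap ℂ[X] (RatFunc ℂ))) :=
      (hprim.irreducible_iff_irreducible_map_fraction_map).1 hp
    have hcop : IsCoprime (p.map (algebraMap ℂ[X] (RatFunc ℂ)))
        (q.map (algebraMap ℂ[X] (RatFunc ℂ))) := by
      rw [hirr.coprime_iff_not_dvd]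
      exact fun h => hpq (IsPrimitive.dvd_of_fraction_map_dvd_fraction_map hprim h)
    obtain ⟨a, b, hab⟩ := hcop
    obtain ⟨s, hs, hsa⟩ := IsLocalization.integerNormalization_spec (nonZeroDivisors ℂ[X]) a
    obtain ⟨t, ht, htb⟩ := IsLocalization.integerNormalization_spec (nonZeroDivisors ℂ[X]) b
    set A := IsLocalization.integerNormalization (nonZeroDivisors ℂ[X]) a
    set B := IsLocalization.integerNormalization (nonZeroDivisors ℂ[X]) b
    -- Bézout over the field of rational functions in `x`, with the denominators `s` and `t`
    -- cleared.
    have key : C t * A * p + C s * B * q = C (s * t) := by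
      apply map_injective (algebraMap ℂ[X] (RatFunc ℂ)) (RatFunc.algebraMap_injective ℂ)
      have e1 : s • a = C (algebraMap ℂ[X] (RatFunc ℂ) s) * a := by
        rw [algebra_compatible_smul (RatFunc ℂ) s a, smul_eq_C_mul]
      have e2 : t • b = C (algebraMap ℂ[X] (RatFunc ℂ) t) * b := by
        rw [algebra_compatible_smul (RatFunc ℂ) t b, smul_eq_C_mul]
      simp only [Polynomial.map_add, Polynomial.map_mul, map_C, hsa, htb, map_mul, e1, e2]
      linear_combination (C (algebraMap ℂ[X] (RatFunc ℂ) s) * C (algebraMap ℂ[X] (RatFunc ℂ) t))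
        * hab
    refine ⟨s * t, mul_ne_zero (nonZeroDivisors.ne_zero hs) (nonZeroDivisors.ne_zero ht),
      fun x y h1 h2 => ?_⟩
    rw [← evalEval_C x y, ← key, evalEval_add, evalEval_mul, evalEval_mul, h1, mul_zero,
      evalEval_mul, h2, mul_zero, add_zero]

open Polynomial in
/-- An irreducible bivariate polynomial has only finitely many common zeros with a polynomial
it does not divide. -/
theorem Polynomial.finite_common_zeros {p q : ℂ[X][X]} (hp : Irreducible p) (hpq : ¬ p ∣ q) :
    {z : ℂ × ℂ | p.evalEval z.1 z.2 = 0 ∧ q.evalEval z.1 z.2 = 0}.Finite := by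
  obtain ⟨d, hd, hx⟩ := exists_ne_zero_eval_eq_zero_of_not_dvd hp hpq
  -- Exchanging the variables bounds the ordinates as well.
  obtain ⟨e, he, hy⟩ := exists_ne_zero_eval_eq_zero_of_not_dvd
    ((MulEquiv.irreducible_iff (Bivariate.swap (R := ℂ))).2 hp)
    (fun h => hpq ((map_dvd_iff (Bivariate.swap (R := ℂ))).1 h))
  refine ((d.rootSet_finite ℂ).prod (e.rootSet_finite ℂ)).subset fun z hz => ?_
  simp only [Set.mem_prod, mem_rootSet, coe_aeval_eq_eval]
  exact ⟨⟨hd, hx _ _ hz.1 hz.2⟩, he, hy z.2 z.1 (by rw [Bivariate.evalEval_swap, hz.1])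
    (by rw [Bivariate.evalEval_swap, hz.2])⟩

open Polynomial in
/-- Up to finitely many points, the zeros in `T` of a nonzero bivariate polynomial are those of a
polynomial that divides every polynomial vanishing on them. -/
theorem Polynomial.exists_dvd_of_vanishing (T : Set (ℂ × ℂ)) {p : ℂ[X][X]} (hp : p ≠ 0) :
    ∃ q : ℂ[X][X],
      (∀ z ∈ T, q.evalEval z.1 z.2 = 0 → p.evalEval z.1 z.2 = 0) ∧
      {z ∈ T | p.evalEval z.1 z.2 = 0 ∧ q.evalEval z.1 z.2 ≠ 0}.Finite ∧
      ∀ f : ℂ[X][X], (∀ z ∈ T, q.evalEval z.1 z.2 = 0 → f.evalEval z.1 z.2 = 0) → q ∣ f := by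
  induction p using UniqueFactorizationMonoid.induction_on_prime with
  | h₁ => exact absurd rfl hp
  | h₂ u hu =>
    refine ⟨1, fun z _ h => ?_, ?_, fun _ _ => one_dvd _⟩
    · simp at h
    · convert Set.finite_empty
      ext z
      simp only [Set.mem_ofPred_eq, Set.mem_empty_iff_false, iff_false, not_and]
      exact fun _ h => absurd h (hu.map (evalEvalRingHom z.1 z.2)).ne_zero
  | h₃ a π ha hπ ih =>
    obtain ⟨q, h1, h2, h3⟩ := ih ha
    -- A prime is discarded if it is already present or has only finitely many zeros in `T`.
    by_cases hcase : π ∣ q ∨ {z ∈ T | π.evalEval z.1 z.2 = 0}.Finite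
    · refine ⟨q, fun z hz h => by rw [evalEval_mul, h1 z hz h, mul_zero], ?_, h3⟩
      rcases hcase with h | h
      · refine h2.subset fun z hz => ⟨hz.1, ?_, hz.2.2⟩
        have hne : π.evalEval z.1 z.2 ≠ 0 := fun h0 =>
          hz.2.2 (zero_dvd_iff.1 (h0 ▸ evalEval_dvd z.1 z.2 h))
        exact (mul_eq_zero.1 ((evalEval_mul z.1 z.2 π a).symm.trans hz.2.1)).resolve_left hne
      · refine (h2.union h).subset fun z hz => ?_
        rcases mul_eq_zero.1 ((evalEval_mul z.1 z.2 π a).symm.trans hz.2.1) with h0 | h0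
        · exact Or.inr ⟨hz.1, h0⟩
        · exact Or.inl ⟨hz.1, h0, hz.2.2⟩
    · push Not at hcase
      refine ⟨π * q, fun z hz h => ?_, h2.subset fun z hz => ?_, fun f hf => ?_⟩
      · rw [evalEval_mul, mul_eq_zero] at h ⊢
        exact h.imp_right (h1 z hz)
      · have hz2 := hz.2
        rw [evalEval_mul, evalEval_mul, mul_eq_zero, mul_ne_zero_iff] at hz2
        exact ⟨hz.1, hz2.1.resolve_left hz2.2.1, hz2.2.2⟩
      · obtain ⟨t, rfl⟩ := h3 f fun z hz h => hf z hz (by rw [evalEval_mul, h, mul_zero])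
        have hdvd : π ∣ q * t := by
          by_contra hnd
          refine hcase.2 ((finite_common_zeros hπ.irreducible hnd).subset fun z hz => ⟨hz.2, ?_⟩)
          exact hf z hz.1 (by rw [evalEval_mul, hz.2, zero_mul])
        obtain ⟨s, rfl⟩ := (hπ.dvd_or_dvd hdvd).resolve_left hcase.1
        exact ⟨s, by ring⟩

/-! ### Extreme exponents of Laurent polynomials -/

/-- The product of two nonzero elements of an additive monoid algebra attains its extreme
exponents at the sums of the extreme exponents of the factors. -/
theorem AddMonoidAlgebra.exists_extreme_add_mem_support {M B : Type*} [AddCommMonoid M]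
    [AddCommGroup B] [LinearOrder B] [IsOrderedAddMonoid B] (D : M →+ B)
    (hD : Function.Injective D) {f g : AddMonoidAlgebra ℂ M} (hf : f ≠ 0) (hg : g ≠ 0) :
    ∃ a ∈ f.coeff.support, ∃ b ∈ g.coeff.support, a + b ∈ (f * g).coeff.support ∧
      (∀ a' ∈ f.coeff.support, D a' ≤ D a) ∧ ∀ b' ∈ g.coeff.support, D b' ≤ D b := by
  obtain ⟨a, ha, hamax⟩ := f.coeff.support.exists_max_image D
    (Finsupp.support_nonempty_iff.2 (mt AddMonoidAlgebra.coeff_eq_zero.1 hf))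
  obtain ⟨b, hb, hbmax⟩ := g.coeff.support.exists_max_image D
    (Finsupp.support_nonempty_iff.2 (mt AddMonoidAlgebra.coeff_eq_zero.1 hg))
  refine ⟨a, ha, b, hb, ?_, hamax, hbmax⟩
  have huniq : UniqueAdd f.coeff.support g.coeff.support a b := by
    intro a' b' ha' hb' h
    have h1 := hamax a' ha'
    have h2 := hbmax b' hb'
    have h3 : D a' + D b' = D a + D b := by rw [← map_add, h, map_add]
    have h4 : D a' = D a := by
      refine le_antisymm h1 (not_lt.1 fun h5 => ?_)
      exact (add_lt_add_of_lt_of_le h5 h2).ne h3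
    refine ⟨hD h4, hD ?_⟩
    rw [h4] at h3
    exact add_left_cancel h3
  rw [Finsupp.mem_support_iff, AddMonoidAlgebra.coeff_mul_add_of_uniqueAdd huniq]
  exact mul_ne_zero (Finsupp.mem_support_iff.1 ha) (Finsupp.mem_support_iff.1 hb)

/-- The lexicographic comparison of lattice points by two coordinates. -/
def lexHom (φ ψ : ℤ × ℤ →+ ℤ) : ℤ × ℤ →+ ℤ ×ₗ ℤ where
  toFun k := toLex (φ k, ψ k)
  map_zero' := by rw [map_zero, map_zero]; rfl
  map_add' k l := by rw [map_add, map_add]; rfl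

theorem lexHom_injective {φ ψ : ℤ × ℤ →+ ℤ} (h : Function.Injective (φ.prod ψ)) :
    Function.Injective (lexHom φ ψ) := fun _ _ hkl => h (toLex.injective hkl)

theorem le_of_lexHom_le {φ ψ : ℤ × ℤ →+ ℤ} {k l : ℤ × ℤ} (h : lexHom φ ψ k ≤ lexHom φ ψ l) :
    φ k ≤ φ l := by
  rcases Prod.Lex.le_iff.1 h with h | h
  · exact h.le
  · exact h.1.le

namespace TrigPoly

theorem mem_intHull {S : Finset ℤ} {n : ℤ} :
    n ∈ intHull S ↔ ∃ a ∈ S, ∃ b ∈ S, a ≤ n ∧ n ≤ b := by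
  simp only [intHull, Finset.mem_biUnion, Finset.mem_Icc]

/-- The extreme values of `φ` on the support of a product are sums of those of the factors, so the
hull of `f`, translated by the top value of `g`, fits into the hull of `f * g`. The second
coordinate `ψ` only breaks ties. -/
theorem card_intHull_le_of_mul {φ ψ : ℤ × ℤ →+ ℤ} (h : Function.Injective (φ.prod ψ))
    {f g : AddMonoidAlgebra ℂ (ℤ × ℤ)} (hf : f ≠ 0) (hg : g ≠ 0) :
    (intHull (f.coeff.support.image φ)).card ≤ (intHull ((f * g).coeff.support.image φ)).card := by
  obtain ⟨a, ha, b, hb, hab, hamax, hbmax⟩ :=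
    AddMonoidAlgebra.exists_extreme_add_mem_support _ (lexHom_injective h) hf hg
  have h' : Function.Injective ((-φ).prod ψ) := fun k l hkl => h (by
    simp only [AddMonoidHom.prod_apply, AddMonoidHom.neg_apply, Prod.mk.injEq, neg_inj] at hkl ⊢
    exact hkl)
  obtain ⟨a', ha', b', hb', hab', hamin, hbmin⟩ :=
    AddMonoidAlgebra.exists_extreme_add_mem_support _ (lexHom_injective h') hf hg
  refine Finset.card_le_card_of_injOn (· + φ b) (fun n hn => ?_)
    (add_left_injective (φ b)).injOn
  obtain ⟨x, hx, y, hy, hxn, hny⟩ := mem_intHull.1 hn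
  obtain ⟨x, hx', rfl⟩ := Finset.mem_image.1 hx
  obtain ⟨y, hy', rfl⟩ := Finset.mem_image.1 hy
  refine mem_intHull.2 ⟨_, Finset.mem_image_of_mem φ hab', _, Finset.mem_image_of_mem φ hab, ?_, ?_⟩
  · have h1 := le_of_lexHom_le (hamin x hx')
    have h2 := le_of_lexHom_le (hbmax b' hb')
    simp only [AddMonoidHom.neg_apply, map_add] at h1 h2 ⊢
    linarith
  · have h1 := le_of_lexHom_le (hamax y hy')
    simp only [map_add]
    linarith

theorem injective_fst_prod_snd : Function.Injective
    ((AddMonoidHom.fst ℤ ℤ).prod (AddMonoidHom.snd ℤ ℤ)) := fun _ _ h => h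

theorem injective_snd_prod_fst : Function.Injective
    ((AddMonoidHom.snd ℤ ℤ).prod (AddMonoidHom.fst ℤ ℤ)) := fun _ _ h =>
  Prod.ext (congrArg Prod.snd h) (congrArg Prod.fst h)

theorem degree_le_degree_mul {f g : AddMonoidAlgebra ℂ (ℤ × ℤ)} (hf : f ≠ 0) (hg : g ≠ 0) :
    degree f.coeff ≤ degree (f * g).coeff :=
  Prod.mk_le_mk.2 ⟨card_intHull_le_of_mul injective_fst_prod_snd hf hg,
    card_intHull_le_of_mul injective_snd_prod_fst hf hg⟩

/-- Units of the ring of Laurent polynomials in two variables are monomials. -/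
theorem exists_eq_single_of_mul_eq_one {f g : AddMonoidAlgebra ℂ (ℤ × ℤ)} (h : f * g = 1) :
    ∃ (k : ℤ × ℤ) (a : ℂ), a ≠ 0 ∧ f = AddMonoidAlgebra.single k a := by
  have hf : f ≠ 0 := left_ne_zero_of_mul_eq_one h
  have hg : g ≠ 0 := right_ne_zero_of_mul_eq_one h
  have hD := lexHom_injective injective_fst_prod_snd
  set D := lexHom (AddMonoidHom.fst ℤ ℤ) (AddMonoidHom.snd ℤ ℤ)
  have hD' : Function.Injective (-D) := fun _ _ hkl => hD (neg_injective hkl)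
  obtain ⟨a, ha, b, hb, hab, hamax, hbmax⟩ :=
    AddMonoidAlgebra.exists_extreme_add_mem_support D hD hf hg
  obtain ⟨a', ha', b', hb', hab', hamin, hbmin⟩ :=
    AddMonoidAlgebra.exists_extreme_add_mem_support (-D) hD' hf hg
  have hone : ∀ k ∈ (f * g).coeff.support, k = 0 := fun k hk => by
    rw [h, AddMonoidAlgebra.one_def, AddMonoidAlgebra.coeff_single] at hk
    exact Finset.mem_singleton.1 (Finsupp.support_single_subset hk)
  -- The support of `1` is a single point, so the top and bottom sums agree, which forces top and
  -- bottom of `f` to agree.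
  have h1 : D a + D b = D a' + D b' := by rw [← map_add, ← map_add, hone _ hab, hone _ hab']
  have h2 : D a' = D a := by
    refine le_antisymm (hamax a' ha') (not_lt.1 fun h5 => ?_)
    exact (add_lt_add_of_lt_of_le h5 (hbmax b' hb')).ne h1.symm
  refine ⟨a, f.coeff a, Finsupp.mem_support_iff.1 ha, ?_⟩
  refine AddMonoidAlgebra.coeff_injective ?_
  rw [AddMonoidAlgebra.coeff_single, ← Finsupp.support_subset_singleton]
  intro x hx
  have h3 := hamin x hx
  simp only [AddMonoidHom.neg_apply, neg_le_neg_iff] at h3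
  exact Finset.mem_singleton.2 (hD (le_antisymm (hamax x hx) (h2 ▸ h3)))

/-- A positive `φ k` would push the maximum out of the hull, a negative one the minimum. -/
theorem shift_eq_zero_of_intHull_subset {φ : ℤ × ℤ →+ ℤ} {S S' : Finset (ℤ × ℤ)} {k : ℤ × ℤ} (hS : S.Nonempty)
    (hk : ∀ a ∈ S, a + k ∈ S') (h : intHull (S'.image φ) ⊆ intHull (S.image φ)) : φ k = 0 := by
  obtain ⟨a, ha, hamax⟩ := S.exists_max_image φ hS
  obtain ⟨b, hb, hbmin⟩ := S.exists_min_image φ hS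
  have key : ∀ x ∈ S, φ b ≤ φ (x + k) ∧ φ (x + k) ≤ φ a := fun x hx => by
    obtain ⟨u, hu, v, hv, h1, h2⟩ :=
      mem_intHull.1 (h (subset_intHull _ (Finset.mem_image_of_mem φ (hk x hx))))
    obtain ⟨u, hu', rfl⟩ := Finset.mem_image.1 hu
    obtain ⟨v, hv', rfl⟩ := Finset.mem_image.1 hv
    exact ⟨(hbmin u hu').trans h1, h2.trans (hamax v hv')⟩
  have h1 := (key a ha).2
  have h2 := (key b hb).1
  rw [map_add] at h1 h2
  linarith

theorem eq_zero_of_freqRect_eq {c d : TrigPoly} {k : ℤ × ℤ} (hc : c ≠ 0)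
    (hk : ∀ a ∈ c.support, a + k ∈ d.support) (h : d.freqRect = c.freqRect) : k = 0 := by
  have hne : c.support.Nonempty := Finsupp.support_nonempty_iff.2 hc
  have hne' : d.support.Nonempty := hne.imp' (· + k) hk
  have hI : ∀ {S : Finset ℤ}, S.Nonempty → (intHull S).Nonempty := fun hS =>
    hS.mono (subset_intHull _)
  have h' := (Set.prod_eq_prod_iff_of_nonempty
    (s := (intHull (d.support.image Prod.fst) : Set ℤ))
    (t := (intHull (d.support.image Prod.snd) : Set ℤ))
    (s₁ := (intHull (c.support.image Prod.fst) : Set ℤ))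
    (t₁ := (intHull (c.support.image Prod.snd) : Set ℤ))
    ⟨((hI (hne'.image _)).choose, (hI (hne'.image _)).choose),
      (hI (hne'.image _)).choose_spec, (hI (hne'.image _)).choose_spec⟩).1 (by
        rw [← Finset.coe_product, ← Finset.coe_product]; exact congrArg _ h)
  exact Prod.ext
    (shift_eq_zero_of_intHull_subset (φ := AddMonoidHom.fst ℤ ℤ) hne hk (Finset.coe_injective h'.1).subset)
    (shift_eq_zero_of_intHull_subset (φ := AddMonoidHom.snd ℤ ℤ) hne hk (Finset.coe_injective h'.2).subset)

end TrigPoly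

/-! ### Trigonometric polynomials as Laurent polynomials -/

namespace TrigPoly

theorem expo_zero (r : ℝ × ℝ) : expo 0 r = 1 := by simp [expo]

theorem expo_add (k l : ℤ × ℤ) (r : ℝ × ℝ) : expo (k + l) r = expo k r * expo l r := by
  rw [expo, expo, expo, ← Complex.exp_add]
  congr 1
  push_cast [Prod.fst_add, Prod.snd_add]
  ring

theorem expo_ne_zero (k : ℤ × ℤ) (r : ℝ × ℝ) : expo k r ≠ 0 := Complex.exp_ne_zero _

theorem expo_add_right (k : ℤ × ℤ) (r s : ℝ × ℝ) : expo k (r + s) = expo k r * expo k s := by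
  rw [expo, expo, expo, ← Complex.exp_add]
  congr 1
  push_cast [Prod.fst_add, Prod.snd_add]
  ring

theorem expo_int (k n : ℤ × ℤ) : expo k ((n.1 : ℝ), (n.2 : ℝ)) = 1 := by
  rw [expo, Complex.exp_eq_one_iff]
  refine ⟨k.1 * n.1 + k.2 * n.2, ?_⟩
  push_cast
  ring

theorem expo_eq_pow (m n : ℕ) (r : ℝ × ℝ) :
    expo ((m : ℤ), (n : ℤ)) r = expo (1, 0) r ^ m * expo (0, 1) r ^ n := by
  rw [expo, expo, expo, ← Complex.exp_nat_mul, ← Complex.exp_nat_mul, ← Complex.exp_add]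
  congr 1
  push_cast
  ring

/-- The exponential `e_k` as a character of `ℝ²`. -/
noncomputable def expoHom (k : ℤ × ℤ) : Multiplicative (ℝ × ℝ) →* ℂ where
  toFun r := expo k r.toAdd
  map_one' := by simp [expo]
  map_mul' r s := expo_add_right k r.toAdd s.toAdd

theorem intCast_eq_zero_of_exp_eq_one {m : ℤ}
    (h : ∀ t : ℝ, Complex.exp (2 * (Real.pi : ℂ) * Complex.I * ((m : ℂ) * (t : ℂ))) = 1) :
    m = 0 := by
  by_contra hm
  have hm' : (m : ℂ) ≠ 0 := Int.cast_ne_zero.2 hm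
  -- At `t = 1 / (2m)` the exponential is `-1`.
  have h1 := h ((m : ℝ)⁻¹ / 2)
  have h2 : 2 * (Real.pi : ℂ) * Complex.I * ((m : ℂ) * (((m : ℝ)⁻¹ / 2 : ℝ) : ℂ)) =
      Real.pi * Complex.I := by
    push_cast
    field_simp
  rw [h2, Complex.exp_pi_mul_I] at h1
  norm_num at h1

theorem expoHom_injective : Function.Injective expoHom := by
  intro k l hkl
  have h : ∀ r : ℝ × ℝ, expo (k - l) r = 1 := fun r => by
    have h1 : expo k r = expo l r := DFunLike.congr_fun hkl (Multiplicative.ofAdd r)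
    have h2 := expo_add (k - l) l r
    rw [sub_add_cancel, h1] at h2
    exact (mul_eq_right₀ (expo_ne_zero l r)).1 h2.symm
  refine sub_eq_zero.1 (Prod.ext ?_ ?_)
  · exact intCast_eq_zero_of_exp_eq_one fun t => by simpa [expo] using h (t, 0)
  · exact intCast_eq_zero_of_exp_eq_one fun t => by simpa [expo] using h (0, t)

/-- Distinct characters are linearly independent (Dedekind). -/
theorem eq_zero_of_eval_eq_zero {c : TrigPoly} (h : ∀ r, c.eval r = 0) : c = 0 := by
  have hli := (linearIndependent_monoidHom (Multiplicative (ℝ × ℝ)) ℂ).comp expoHom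
    expoHom_injective
  refine (linearIndependent_iff.1 hli) c (funext fun r => ?_)
  rw [Finsupp.linearCombination_apply, Finsupp.sum, Finset.sum_apply]
  exact h r.toAdd

/-- Evaluation at a point as a homomorphism from the ring of Laurent polynomials. -/
noncomputable def evalHom (r : ℝ × ℝ) : AddMonoidAlgebra ℂ (ℤ × ℤ) →ₐ[ℂ] ℂ :=
  AddMonoidAlgebra.lift ℂ ℂ (ℤ × ℤ)
    { toFun := fun k => expo k.toAdd r
      map_one' := expo_zero r
      map_mul' := fun k l => expo_add k.toAdd l.toAdd r }

theorem evalHom_apply (r : ℝ × ℝ) (f : AddMonoidAlgebra ℂ (ℤ × ℤ)) :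
    evalHom r f = eval f.coeff r := by
  rw [evalHom, AddMonoidAlgebra.lift_apply]
  rfl

theorem evalHom_single (r : ℝ × ℝ) (k : ℤ × ℤ) (a : ℂ) :
    evalHom r (AddMonoidAlgebra.single k a) = a * expo k r := by
  rw [evalHom, AddMonoidAlgebra.lift_single]
  rfl

theorem eval_coeff_single_mul (k : ℤ × ℤ) (a : ℂ) (c : TrigPoly) (r : ℝ × ℝ) :
    eval (AddMonoidAlgebra.single k a * AddMonoidAlgebra.ofCoeff c).coeff r =
      a * expo k r * c.eval r := by
  rw [← evalHom_apply, map_mul, evalHom_single, evalHom_apply]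

theorem eq_of_evalHom_eq {f g : AddMonoidAlgebra ℂ (ℤ × ℤ)} (h : ∀ r, evalHom r f = evalHom r g) :
    f = g := by
  refine sub_eq_zero.1 (AddMonoidAlgebra.coeff_eq_zero.1 (eq_zero_of_eval_eq_zero fun r => ?_))
  rw [← evalHom_apply, map_sub, h, sub_self]

theorem divides_iff {c d : TrigPoly} : c.Divides d ↔
    AddMonoidAlgebra.ofCoeff c ∣ AddMonoidAlgebra.ofCoeff d := by
  constructor
  · rintro ⟨g, hg⟩
    refine ⟨AddMonoidAlgebra.ofCoeff g, eq_of_evalHom_eq fun r => ?_⟩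
    rw [map_mul, evalHom_apply, evalHom_apply, evalHom_apply]
    exact hg r
  · rintro ⟨g, hg⟩
    refine ⟨g.coeff, fun r => ?_⟩
    have h := congrArg (evalHom r) hg
    rw [map_mul, evalHom_apply, evalHom_apply, evalHom_apply] at h
    exact h

theorem Divides.degree_le {c d : TrigPoly} (h : c.Divides d) (hd : d ≠ 0) :
    c.degree ≤ d.degree := by
  obtain ⟨g, hg⟩ := divides_iff.1 h
  have hd' : AddMonoidAlgebra.ofCoeff d ≠ 0 := fun h0 => hd (AddMonoidAlgebra.coeff_eq_zero.2 h0)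
  rw [hg] at hd'
  have := degree_le_degree_mul (left_ne_zero_of_mul hd') (right_ne_zero_of_mul hd')
  rwa [← hg] at this

/-- Trigonometric polynomials dividing one another differ by a monomial factor. -/
theorem Divides.exists_eq_expo_mul {c d : TrigPoly} (h : c.Divides d) (h' : d.Divides c) :
    ∃ (a : ℂ) (k : ℤ × ℤ), a ≠ 0 ∧ ∀ r, d.eval r = a * expo k r * c.eval r := by
  obtain ⟨u, hu⟩ := associated_of_dvd_dvd (divides_iff.1 h) (divides_iff.1 h')
  obtain ⟨k, a, ha, hk⟩ := exists_eq_single_of_mul_eq_one (Units.mul_inv u)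
  refine ⟨a, k, ha, fun r => ?_⟩
  have h1 := congrArg (evalHom r) hu
  rw [map_mul, hk, evalHom_single, evalHom_apply, evalHom_apply] at h1
  rw [mul_comm]
  exact h1.symm

theorem eval_fract (c : TrigPoly) (r : ℝ × ℝ) :
    c.eval (Int.fract r.1, Int.fract r.2) = c.eval r := by
  refine Finset.sum_congr rfl fun k _ => ?_
  have h : r = (Int.fract r.1, Int.fract r.2) + ((⌊r.1⌋ : ℝ), (⌊r.2⌋ : ℝ)) :=
    Prod.ext (Int.fract_add_floor r.1).symm (Int.fract_add_floor r.2).symm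
  conv_rhs => rw [h, expo_add_right, expo_int k (⌊r.1⌋, ⌊r.2⌋), mul_one]

theorem zeroSet_eq_iff {c d : TrigPoly} :
    c.zeroSet = d.zeroSet ↔ ∀ r, c.eval r = 0 ↔ d.eval r = 0 := by
  constructor
  · intro h r
    have hmem : ((Int.fract r.1, Int.fract r.2) : ℝ × ℝ) ∈
        Set.Icc (0 : ℝ) 1 ×ˢ Set.Icc (0 : ℝ) 1 :=
      ⟨⟨Int.fract_nonneg _, (Int.fract_lt_one _).le⟩, Int.fract_nonneg _, (Int.fract_lt_one _).le⟩
    have h1 := Set.ext_iff.1 h (Int.fract r.1, Int.fract r.2)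
    simp only [zeroSet, Set.mem_ofPred_eq, hmem, true_and, eval_fract] at h1
    exact h1
  · intro h
    ext r
    simp only [zeroSet, Set.mem_ofPred_eq, h]

/-! ### Zero sets on the torus and the minimal polynomial -/

/-- The point of the complex torus above a point of the plane. -/
noncomputable def torusPoint (r : ℝ × ℝ) : ℂ × ℂ := (expo (1, 0) r, expo (0, 1) r)

theorem continuous_expo (k : ℤ × ℤ) : Continuous (expo k) := by
  unfold expo
  fun_prop

theorem continuous_eval (c : TrigPoly) : Continuous c.eval :=
  continuous_finsetSum _ fun k _ => continuous_const.mul (continuous_expo k)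

theorem eq_of_exp_eq {x y : ℝ} (h : Complex.exp (2 * (Real.pi : ℂ) * Complex.I * (x : ℂ)) =
    Complex.exp (2 * (Real.pi : ℂ) * Complex.I * (y : ℂ))) (hxy : |x - y| < 1) : x = y := by
  obtain ⟨n, hn⟩ := Complex.exp_eq_exp_iff_exists_int.1 h
  have h1 : (x : ℂ) = y + n :=
    mul_left_cancel₀ Complex.two_pi_I_ne_zero (by linear_combination hn)
  have h2 : x = y + n := by exact_mod_cast h1
  rw [h2, add_sub_cancel_left] at hxy
  have h3 : n = 0 := Int.abs_lt_one_iff.1 (by exact_mod_cast hxy)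
  rw [h2, h3, Int.cast_zero, add_zero]

/-- Points of the ball differ by less than `1` in each coordinate, hence by no nonzero lattice
vector. -/
theorem torusPoint_injOn_ball (r : ℝ × ℝ) : Set.InjOn torusPoint (Metric.ball r (1 / 2)) := by
  intro s hs t ht h
  have hd : dist s t < 1 := by
    have := dist_triangle_right s t r
    rw [Metric.mem_ball] at hs ht
    linarith
  rw [Prod.dist_eq, max_lt_iff, Real.dist_eq, Real.dist_eq] at hd
  have h1 := congrArg Prod.fst h
  have h2 := congrArg Prod.snd h
  simp only [torusPoint, expo, Int.cast_one, Int.cast_zero, one_mul, zero_mul, add_zero,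
    zero_add] at h1 h2
  exact Prod.ext (eq_of_exp_eq h1 hd.1) (eq_of_exp_eq h2 hd.2)

/-- A perfect zero set is not enlarged by finitely many points of the torus. -/
theorem eval_eq_zero_of_finite_diff {c d : TrigPoly} {F : Set (ℂ × ℂ)} (hF : F.Finite)
    (hc : Preperfect {r : ℝ × ℝ | c.eval r = 0})
    (h : ∀ r, c.eval r = 0 → d.eval r ≠ 0 → torusPoint r ∈ F) {r : ℝ × ℝ} (hr : c.eval r = 0) :
    d.eval r = 0 := by
  by_contra hd
  have hacc := accPt_iff_frequently.1 (hc r hr)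
  -- Near `r`, where `d` does not vanish, every zero of `c` lies above `F`; there are finitely many
  -- such points, so they cannot accumulate at `r`.
  have hfin : (Metric.ball r (1 / 2) ∩ torusPoint ⁻¹' F).Finite :=
    Set.Finite.of_finite_image (hF.subset (Set.image_subset_iff.2 Set.inter_subset_right))
      ((torusPoint_injOn_ball r).mono Set.inter_subset_left)
  have h1 : ∀ᶠ s in nhds r, d.eval s ≠ 0 := (continuous_eval d).continuousAt.eventually_ne hd
  have h2 : ∀ᶠ s in nhds r, s ∈ Metric.ball r (1 / 2) := Metric.ball_mem_nhds r (by norm_num)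
  have h3 : ∀ᶠ s in nhds r, s ∉ (Metric.ball r (1 / 2) ∩ torusPoint ⁻¹' F) \ {r} :=
    (hfin.subset Set.sdiff_subset).isClosed.isOpen_compl.mem_nhds fun hmem => hmem.2 rfl
  obtain ⟨s, ⟨hsr, hs⟩, hs1, hs2, hs3⟩ := (hacc.and_eventually (h1.and (h2.and h3))).exists
  exact hs3 ⟨⟨hs2, h s hs hs1⟩, hsr⟩

open Polynomial in
theorem exists_eval_eq_evalEval (p : ℂ[X][X]) :
    ∃ c : TrigPoly, ∀ r, c.eval r = p.evalEval (torusPoint r).1 (torusPoint r).2 := by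
  refine ⟨(aevalAeval (AddMonoidAlgebra.single (1, 0) 1 : AddMonoidAlgebra ℂ (ℤ × ℤ))
    (AddMonoidAlgebra.single (0, 1) 1) p).coeff, fun r => ?_⟩
  rw [← evalHom_apply]
  induction p using Polynomial.induction_on' with
  | add p q hp hq => rw [map_add, map_add, hp, hq, evalEval_add]
  | monomial n a =>
    rw [← C_mul_X_pow_eq_monomial]
    simp only [map_mul, map_pow, aevalAeval_C, aevalAeval_Y, evalHom_single, evalEval_mul,
      evalEval_pow, evalEval_C, evalEval_X, ← aeval_algHom_apply, one_mul]
    rfl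

open Polynomial in
theorem exists_evalEval_eq_expo_mul_eval (c : TrigPoly) :
    ∃ (p : ℂ[X][X]) (k : ℤ × ℤ), ∀ r,
      p.evalEval (torusPoint r).1 (torusPoint r).2 = expo k r * c.eval r := by
  -- Shifting by `(N, N)` makes all exponents nonnegative.
  obtain ⟨N, hN⟩ := (c.support.image fun k => max (-k.1) (-k.2)).exists_le
  refine ⟨∑ k ∈ c.support, C (C (c k) * X ^ (k.1 + N).toNat) * X ^ (k.2 + N).toNat, (N, N),
    fun r => ?_⟩
  rw [evalEval_finsetSum, eval, Finset.mul_sum]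
  refine Finset.sum_congr rfl fun k hk => ?_
  have h1 := max_le_iff.1 (hN _ (Finset.mem_image_of_mem _ hk))
  have h2 : expo (N, N) r * expo k r =
      expo (1, 0) r ^ (k.1 + N).toNat * expo (0, 1) r ^ (k.2 + N).toNat := by
    rw [← expo_eq_pow, Int.toNat_of_nonneg (by linarith), Int.toNat_of_nonneg (by linarith),
      ← expo_add, add_comm]
    rfl
  simp only [evalEval_mul, evalEval_pow, evalEval_C, evalEval_X, eval_mul, eval_C, eval_pow,
    eval_X, torusPoint]
  linear_combination -c k * h2

/-- A trigonometric curve is the zero set of a trigonometric polynomial that divides every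
trigonometric polynomial with this zero set. -/
theorem exists_divides_of_isTrigCurve {C : Set (ℝ × ℝ)} (hC : IsTrigCurve C) :
    ∃ c : TrigPoly, c.zeroSet = C ∧ ∀ d : TrigPoly, d.zeroSet = C → c.Divides d := by
  obtain ⟨m, rfl, hm⟩ := hC
  obtain ⟨p, k, hp⟩ := exists_evalEval_eq_expo_mul_eval m
  -- Here `m` vanishes identically, and so does every `d` with the same zero set.
  by_cases hp0 : p = 0
  · refine ⟨m, rfl, fun d hd => ⟨0, fun r => ?_⟩⟩
    have hmr : m.eval r = 0 := by
      have h := hp r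
      rw [hp0, Polynomial.evalEval_zero] at h
      exact (mul_eq_zero.1 h.symm).resolve_left (expo_ne_zero k r)
    rw [(zeroSet_eq_iff.1 hd r).2 hmr, hmr, zero_mul]
  obtain ⟨q, h1, h2, h3⟩ := Polynomial.exists_dvd_of_vanishing (Set.range torusPoint) hp0
  obtain ⟨c, hc⟩ := exists_eval_eq_evalEval q
  have hpm : ∀ r, p.evalEval (torusPoint r).1 (torusPoint r).2 = 0 ↔ m.eval r = 0 := fun r => by
    rw [hp, mul_eq_zero, or_iff_right (expo_ne_zero k r)]
  have hcm : ∀ r, c.eval r = 0 ↔ m.eval r = 0 := fun r =>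
    ⟨fun h => (hpm r).1 (h1 _ ⟨r, rfl⟩ (by rw [← hc, h])),
      eval_eq_zero_of_finite_diff h2 hm fun s hs hs' =>
        ⟨⟨s, rfl⟩, (hpm s).2 hs, by rwa [← hc]⟩⟩
  refine ⟨c, zeroSet_eq_iff.2 hcm, fun d hd => ?_⟩
  obtain ⟨f, l, hf⟩ := exists_evalEval_eq_expo_mul_eval d
  obtain ⟨g, rfl⟩ := h3 f (by
    rintro _ ⟨r, rfl⟩ hr
    rw [hf, (zeroSet_eq_iff.1 hd r).2 ((hcm r).1 (by rw [hc, hr])), mul_zero])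
  obtain ⟨e, he⟩ := exists_eval_eq_evalEval g
  -- The factor with exponent `-l` undoes the shift that made `d` a polynomial.
  refine ⟨(AddMonoidAlgebra.single (-l) 1 * AddMonoidAlgebra.ofCoeff e).coeff, fun r => ?_⟩
  have h4 := hf r
  rw [Polynomial.evalEval_mul, ← hc, ← he] at h4
  have h5 : expo (-l) r * expo l r = 1 := by rw [← expo_add, neg_add_cancel, expo_zero]
  rw [eval_coeff_single_mul]
  linear_combination (-expo (-l) r) * h4 - d.eval r * h5

theorem isMinimalTrigPoly_of_divides {C : Set (ℝ × ℝ)} {c : TrigPoly} (hc : c.zeroSet = C)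
    (h : ∀ d : TrigPoly, d.zeroSet = C → c.Divides d) : IsMinimalTrigPoly C c := by
  refine ⟨hc, fun d hd => ⟨?_, h d hd⟩⟩
  -- The zero polynomial has degree `(0, 0)`, so the bound needs `c = 0`, which the common zero set
  -- gives.
  by_cases hd0 : d = 0
  · subst hd0
    have hc0 : c = 0 := eq_zero_of_eval_eq_zero fun r =>
      (zeroSet_eq_iff.1 (hc.trans hd.symm) r).2 (by simp [eval])
    rw [hc0]
  · exact (h d hd).degree_le hd0

theorem add_mem_support_of_eval_eq {c d : TrigPoly} {a : ℂ} {k : ℤ × ℤ} (ha : a ≠ 0)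
    (h : ∀ r, d.eval r = a * expo k r * c.eval r) {l : ℤ × ℤ} (hl : l ∈ c.support) :
    l + k ∈ d.support := by
  have h1 : AddMonoidAlgebra.ofCoeff d = AddMonoidAlgebra.ofCoeff c * .single k a :=
    eq_of_evalHom_eq fun r => by
      rw [map_mul, evalHom_single, evalHom_apply, evalHom_apply, mul_comm]
      exact h r
  have h2 := congrArg (fun f => f.coeff (l + k)) h1
  simp only [AddMonoidAlgebra.coeff_mul_single_add] at h2
  rw [Finsupp.mem_support_iff] at hl ⊢
  exact h2 ▸ mul_ne_zero hl ha

end TrigPoly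

theorem mainTheorem5 (C : Set (ℝ × ℝ)) (hC : IsTrigCurve C) :
    ∃ μ₀ : TrigPoly, IsMinimalTrigPoly C μ₀ ∧
      (∀ μ₁ : TrigPoly, IsMinimalTrigPoly C μ₁ ↔
        ∃ (a : ℂ) (k : ℤ × ℤ), a ≠ 0 ∧
          ∀ r : ℝ × ℝ, μ₁.eval r = a * TrigPoly.expo k r * μ₀.eval r) ∧
      (∀ μ₁ : TrigPoly, IsMinimalTrigPoly C μ₁ → μ₁.freqRect = μ₀.freqRect →
        ∃ a : ℂ, a ≠ 0 ∧ ∀ r : ℝ × ℝ, μ₁.eval r = a * μ₀.eval r) := by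
  obtain ⟨c, hc, hdvd⟩ := TrigPoly.exists_divides_of_isTrigCurve hC
  have huniq : ∀ d : TrigPoly, IsMinimalTrigPoly C d → ∃ (a : ℂ) (k : ℤ × ℤ), a ≠ 0 ∧
      ∀ r : ℝ × ℝ, d.eval r = a * TrigPoly.expo k r * c.eval r := fun d hd =>
    (hdvd d hd.1).exists_eq_expo_mul (hd.2 c hc).2
  refine ⟨c, TrigPoly.isMinimalTrigPoly_of_divides hc hdvd, fun d => ⟨huniq d, ?_⟩,
    fun d hd hrect => ?_⟩
  · rintro ⟨a, k, ha, h⟩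
    refine TrigPoly.isMinimalTrigPoly_of_divides ((TrigPoly.zeroSet_eq_iff.2 fun r => ?_).trans hc)
      fun e he => ?_
    · rw [h, mul_eq_zero, or_iff_right (mul_ne_zero ha (TrigPoly.expo_ne_zero k r))]
    · obtain ⟨g, hg⟩ := hdvd e he
      refine ⟨(AddMonoidAlgebra.single (-k) a⁻¹ * AddMonoidAlgebra.ofCoeff g).coeff, fun r => ?_⟩
      have h1 : TrigPoly.expo (-k) r * TrigPoly.expo k r = 1 := by
        rw [← TrigPoly.expo_add, neg_add_cancel, TrigPoly.expo_zero]
      rw [TrigPoly.eval_coeff_single_mul, h, hg]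
      linear_combination (-c.eval r * g.eval r) * h1 - (c.eval r * g.eval r *
        TrigPoly.expo (-k) r * TrigPoly.expo k r) * mul_inv_cancel₀ ha
  · obtain ⟨a, k, ha, h⟩ := huniq d hd
    refine ⟨a, ha, fun r => ?_⟩
    by_cases hc0 : c = 0
    · rw [h, hc0]
      simp [TrigPoly.eval]
    · have hk := TrigPoly.eq_zero_of_freqRect_eq hc0
        (fun l hl => TrigPoly.add_mem_support_of_eval_eq ha h hl) hrect
      rw [h, hk, TrigPoly.expo_zero, mul_one]
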